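/- Let $\Bbbk$ be an algebraically closed field; a variety is an integral separated scheme of finite type over $\Bbbk$, and "point" means closed point when fibres and differentials are considered. Let $f\colon X\to Z$ be a generically finite (i.e. the fibre over the generic point of $Z$ is finite), surjective, proper morphism of varieties over $\Bbbk$. Let $Y\subset X$ be an integral (irreducible, with its reduced structure) locally closed subset of codimension $1$ that is not contained in the singular locus of $X$ (the set of points whose local ring is not regular). Put $Y^c:=X\setminus Y$ and $H:=f(Y)\cap f(Y^c)$, and let $n$ be a natural number. Assume that: 1. the closure $\bar H$ of $H$ in $Z$ has codimension at least $2$ (the empty set having codimension $\infty$); 2. there is a non-empty open subset of $Y$ at every point $x$ of which the differential $df_x\colon T_xX\to T_{f(x)}Z$ of Zariski tangent spaces is injective; 3. there is a non-empty open subset $V$ of $f(Y)$ such that $f^{-1}(y)$ has cardinality $n$ for each $y\in V$. Then there are an integer $m\le n$ and a non-empty open subset $U$ of $Z$ such that $f^{-1}(y)$ has cardinality $m$ for each $y\in U$. -/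

import Mathlib

open AlgebraicGeometry CategoryTheory TopologicalSpace

universe u

namespace GenericDegree

/-- The codimension of a closed subset `A` of a topological space `T`: the infimum, over all
irreducible closed subsets `B` contained in `A`, of the supremum of the lengths of chains
`B = B₀ ⊊ B₁ ⊊ ⋯ ⊊ Bₗ` of irreducible closed subsets of `T`. The empty set has codimension `⊤`. -/
noncomputable def codim {T : Type*} [TopologicalSpace T] (A : Set T) : ℕ∞ :=
  ⨅ (B : IrreducibleCloseds T) (_ : (B : Set T) ⊆ A), Order.coheight B

/-- The singular locus of a scheme: the set of points whose local ring is not regular. -/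
def singularLocus (X : Scheme.{u}) : Set X :=
  {x | ¬ IsRegularLocalRing (X.presheaf.stalk x)}

/-- A morphism to an irreducible scheme is generically finite if the fibre over the generic point
is finite. -/
def GenericallyFinite {X Z : Scheme.{u}} [IrreducibleSpace Z] (f : X ⟶ Z) : Prop :=
  (f ⁻¹' {genericPoint Z}).Finite

/-- The fibre `f⁻¹(z)` in the sense of classical varieties, whose points are the closed points. -/
def closedFiber {X Z : Scheme.{u}} (f : X ⟶ Z) (z : Z) : Set X :=
  {x | x ∈ closedPoints X ∧ f x = z}

section Differential

open IsLocalRing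

theorem maximalIdeal_le_comap {A B : Type*} [CommRing A] [IsLocalRing A] [CommRing B]
    [IsLocalRing B] (φ : A →+* B) [IsLocalHom φ] :
    maximalIdeal A ≤ (maximalIdeal B).comap φ.toIntAlgHom := fun a ha => by
  rw [Ideal.mem_comap]
  exact map_nonunit φ a ha

/-- The map `𝔪_A / 𝔪_A² → 𝔪_B / 𝔪_B²` induced by a local homomorphism `φ : A → B` of local rings;
it is semilinear over the induced map of residue fields. -/
noncomputable def cotangentMap {A B : Type*} [CommRing A] [IsLocalRing A] [CommRing B]
    [IsLocalRing B] (φ : A →+* B) [IsLocalHom φ] :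
    CotangentSpace A →ₛₗ[ResidueField.map φ] CotangentSpace B where
  toFun := Ideal.mapCotangent (maximalIdeal A) (maximalIdeal B) φ.toIntAlgHom
    (maximalIdeal_le_comap φ)
  map_add' := map_add _
  map_smul' := by
    intro r t
    obtain ⟨a, rfl⟩ := residue_surjective r
    obtain ⟨m, rfl⟩ := Ideal.toCotangent_surjective _ t
    have h1 : residue A a • (maximalIdeal A).toCotangent m
        = (maximalIdeal A).toCotangent (a • m) := by
      rw [map_smul]; rfl
    rw [h1, ResidueField.map_residue, Ideal.mapCotangent_toCotangent,
      Ideal.mapCotangent_toCotangent]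
    have h2 : ∀ (b : B) (y : maximalIdeal B), residue B b • (maximalIdeal B).toCotangent y
        = (maximalIdeal B).toCotangent (b • y) := by
      intro b y
      rw [map_smul]; rfl
    rw [h2]
    congr 1
    ext
    simp

/-- The Zariski tangent space `T_x X = Hom_{κ(x)}(𝔪_x / 𝔪_x², κ(x))`. -/
abbrev TangentSpace (X : Scheme.{u}) (x : X) : Type u :=
  Module.Dual (ResidueField (X.presheaf.stalk x)) (CotangentSpace (X.presheaf.stalk x))

/-- The differential `df_x` of a morphism `f : X ⟶ Z` at a point `x`, with `z = f x`: precomposition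
of a tangent vector `𝔪_x / 𝔪_x² → κ(x)` with the pullback `𝔪_z / 𝔪_z² → 𝔪_x / 𝔪_x²`. Its target is
the space of `κ(z)`-linear maps `𝔪_z / 𝔪_z² → κ(x)`, that is `T_z Z ⊗_{κ(z)} κ(x)` on varieties; at
a closed point `x` of a variety over an algebraically closed field `k` one has
`κ(z) = κ(x) = k`, and the target is the tangent space `T_z Z`. -/
noncomputable def differential {X Z : Scheme.{u}} (f : X ⟶ Z) (x : X) :
    TangentSpace X x →ₗ[ResidueField (X.presheaf.stalk x)]
      (CotangentSpace (Z.presheaf.stalk (f x)) →ₛₗ[ResidueField.map (f.stalkMap x).hom]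
        ResidueField (X.presheaf.stalk x)) where
  toFun D := D.comp (cotangentMap (f.stalkMap x).hom)
  map_add' _ _ := rfl
  map_smul' _ _ := rfl

end Differential

end GenericDegree

namespace GenericDegree

/-! ### Heights of contracted primes, and dimensions of fibres of finite modules. -/

section CommutativeAlgebra

open Module TensorProduct

/-! Everything happens at the generic point `η` of `Y`. Injectivity of `df` at one closed point of
`Y` makes `f` unramified there; the unramified locus is open, so it contains `η`, and `f` is
quasi-finite at `η`. Quasi-finiteness bounds the codimension of `f η` by that of `η`
(`coheight_map_le_of_quasiFiniteAt`), which is at most `1`. Hence `f η` is outside the closure of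
`H`, and its whole fibre lies in `Y`. Every point of that fibre is a specialization of `η`, so by
quasi-finiteness the fibre is `{η}`.

Since `f` is closed, it is unramified over a neighbourhood `U` of `f η`, and there it is finite,
being proper and quasi-finite. For a finite unramified morphism the number of points over a closed
point is the dimension of the fibre algebra. By Nakayama this is at least the generic rank `m`, with
equality on a nonempty open set (`exists_encard_fibre`). Comparison at a closed point of `Y` over
`U` gives `m ≤ n`. -/

theorem height_under_le_of_hasGoingDown {R S : Type*} [CommRing R] [CommRing S] [Algebra R S]
    [Algebra.HasGoingDown R S] (q : Ideal S) [q.IsPrime] :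
    (q.under R).height ≤ q.height := by
  rw [PrimeSpectrum.height_eq_orderHeight ⟨q, inferInstance⟩,
    PrimeSpectrum.height_eq_orderHeight ⟨q.under R, inferInstance⟩]
  refine Order.height_le_iff'.mpr fun l hl => ?_
  have : q.LiesOver l.last.asIdeal := by
    rw [hl]
    exact ⟨rfl⟩
  obtain ⟨L, hlen, hlast, -⟩ := Ideal.exists_ltSeries_of_hasGoingDown l q
  rw [← hlen, ← hlast]
  exact Order.length_le_height_last

theorem height_le_height_under_of_isIntegral {R S : Type*} [CommRing R] [CommRing S] [Algebra R S]
    [Algebra.IsIntegral R S] (q : Ideal S) [q.IsPrime] :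
    q.height ≤ (q.under R).height := by
  rw [PrimeSpectrum.height_eq_orderHeight ⟨q, inferInstance⟩,
    PrimeSpectrum.height_eq_orderHeight ⟨q.under R, inferInstance⟩]
  exact Order.height_le_height_apply_of_strictMono (PrimeSpectrum.comap (algebraMap R S))
    (fun I J h => Ideal.IsIntegral.comap_lt_comap h) ⟨q, inferInstance⟩

/-- The fibre of a module at `p` is the residual fibre of its localization at `p`. -/
noncomputable def fiberEquivLocalizedModule {R : Type*} (M : Type*) [CommRing R] [AddCommGroup M]
    [Module R M] (p : Ideal R) [p.IsPrime] :
    p.ResidueField ⊗[Localization.AtPrime p] LocalizedModule p.primeCompl M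
      ≃ₗ[p.ResidueField] p.Fiber M :=
  (LocalizedModule.equivTensorProduct p.primeCompl M).baseChange
      (Localization.AtPrime p) p.ResidueField _ _ ≪≫ₗ
    AlgebraTensorModule.cancelBaseChange R (Localization.AtPrime p) p.ResidueField p.ResidueField M

theorem finrank_localizedModule_atPrime {R : Type*} (M : Type*) [CommRing R] [IsDomain R]
    [AddCommGroup M] [Module R M] (p : Ideal R) [p.IsPrime] :
    finrank (Localization.AtPrime p) (LocalizedModule p.primeCompl M) = finrank R M :=
  (IsLocalization.finrank_eq _ p.primeCompl p.primeCompl_le_nonZeroDivisors).trans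
    (IsLocalizedModule.finrank_eq p.primeCompl (LocalizedModule.mkLinearMap p.primeCompl M)
      p.primeCompl_le_nonZeroDivisors)

/-- Nakayama: lifts of a basis of the residual fibre span `M`. -/
theorem finrank_le_finrank_residueField_tensorProduct {R M : Type*} [CommRing R] [IsLocalRing R]
    [AddCommGroup M] [Module R M] [Module.Finite R M] :
    finrank R M ≤ finrank (IsLocalRing.ResidueField R) (IsLocalRing.ResidueField R ⊗[R] M) := by
  let b := finBasis (IsLocalRing.ResidueField R) (IsLocalRing.ResidueField R ⊗[R] M)
  choose v hv using fun i => TensorProduct.mk_surjective R M (IsLocalRing.ResidueField R)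
    Ideal.Quotient.mk_surjective (b i)
  have := finrank_le_of_span_eq_top (IsLocalRing.span_eq_top_of_tmul_eq_basis v b hv)
  simpa using this

theorem finrank_le_finrank_fiber {R M : Type*} [CommRing R] [IsDomain R] [AddCommGroup M]
    [Module R M] [Module.Finite R M] (p : Ideal R) [p.IsPrime] :
    finrank R M ≤ finrank p.ResidueField (p.Fiber M) := by
  rw [← (fiberEquivLocalizedModule M p).finrank_eq, ← finrank_localizedModule_atPrime M p]
  exact finrank_le_finrank_residueField_tensorProduct

theorem exists_finrank_fiber_eq (R M : Type*) [CommRing R] [IsDomain R] [IsNoetherianRing R]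
    [AddCommGroup M] [Module R M] [Module.Finite R M] :
    ∃ g : R, g ≠ 0 ∧ ∀ (p : Ideal R) [p.IsPrime], g ∉ p →
      finrank p.ResidueField (p.Fiber M) = finrank R M := by
  have : Module.FinitePresentation R M := Module.finitePresentation_of_finite R M
  -- At the generic point the local ring is a field, so the open free locus is nonempty.
  have hbot : (⊥ : PrimeSpectrum R) ∈ freeLocus R M := by
    rw [mem_freeLocus]
    have hfield : IsField (Localization.AtPrime (⊥ : PrimeSpectrum R).asIdeal) := by
      rw [IsLocalRing.isField_iff_maximalIdeal_eq, ← Localization.AtPrime.map_eq_maximalIdeal]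
      exact Ideal.map_bot
    let := hfield.toField
    infer_instance
  obtain ⟨_, ⟨_, ⟨g, rfl⟩, rfl⟩, hg, hgU⟩ :=
    PrimeSpectrum.isBasis_basic_opens.exists_subset_of_mem_open hbot isOpen_freeLocus
  refine ⟨g, fun h => hg (by simp [h]), fun p _ hp => ?_⟩
  have : Module.Free (Localization.AtPrime p) (LocalizedModule p.primeCompl M) :=
    hgU (show (⟨p, inferInstance⟩ : PrimeSpectrum R) ∈ _ from hp)
  rw [← (fiberEquivLocalizedModule M p).finrank_eq, finrank_baseChange,
    finrank_localizedModule_atPrime M p]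

/-- The fibre algebra is finite étale over an algebraically closed field, hence a product of copies
of that field, one for each point. -/
theorem encard_preimage_eq_finrank_fiber {R S : Type u} [CommRing R] [CommRing S] [Algebra R S]
    [Module.Finite R S] [Algebra.FormallyUnramified R S] (p : PrimeSpectrum R)
    [IsAlgClosed p.asIdeal.ResidueField] :
    (PrimeSpectrum.comap (algebraMap R S) ⁻¹' {p}).encard =
      finrank p.asIdeal.ResidueField (p.asIdeal.Fiber S) := by
  have := Algebra.FormallyEtale.of_formallyUnramified_of_field
    p.asIdeal.ResidueField (p.asIdeal.Fiber S)
  let e' := Algebra.FormallyEtale.equivPiOfIsSepClosed p.asIdeal.ResidueField (p.asIdeal.Fiber S)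
  have : IsArtinianRing (p.asIdeal.Fiber S) := .of_finite p.asIdeal.ResidueField _
  have := Fintype.ofFinite (PrimeSpectrum (p.asIdeal.Fiber S))
  rw [e'.toLinearEquiv.finrank_eq, finrank_pi, ← Nat.card_eq_fintype_card, Set.encard,
    ENat.card_congr (PrimeSpectrum.preimageEquivFiber R S p)]
  simp

/-- Going-down may fail for `A → B`, as `A` need not be normal. Noether normalization supplies a
polynomial ring below `A`: incomparability bounds heights from `A` down to it, and going-down holds
from it up to `B`. -/
theorem height_under_le_of_isIntegral {k A B : Type*} [Field k] [CommRing A] [IsDomain A]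
    [Algebra k A] [Algebra.FiniteType k A] [CommRing B] [IsDomain B] [Algebra A B] [FaithfulSMul A B]
    [Algebra.IsIntegral A B] (q : Ideal B) [q.IsPrime] :
    (q.under A).height ≤ q.height := by
  obtain ⟨s, g, hinj, hg⟩ := exists_integral_inj_algHom_of_fg k A
  algebraize [g.toRingHom, (algebraMap A B).comp g.toRingHom]
  have : Algebra.IsIntegral (MvPolynomial (Fin s) k) B := Algebra.IsIntegral.trans A
  have : FaithfulSMul (MvPolynomial (Fin s) k) A :=
    (faithfulSMul_iff_algebraMap_injective _ _).mpr hinj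
  have : FaithfulSMul (MvPolynomial (Fin s) k) B := .trans _ A _
  calc (q.under A).height ≤ ((q.under A).under (MvPolynomial (Fin s) k)).height :=
        height_le_height_under_of_isIntegral _
    _ = (q.under (MvPolynomial (Fin s) k)).height := by rw [Ideal.under_under]
    _ ≤ q.height := height_under_le_of_hasGoingDown q

/-- By Zariski's main theorem, `B` and the integral closure `C` of `A` in `B` agree after inverting
some `r ∉ q`. So `q` and its contraction to `C` have the same height, and the integral case applies
to `A → C`. -/
theorem height_under_le_of_quasiFiniteAt {k A B : Type*} [Field k] [CommRing A] [IsDomain A]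
    [Algebra k A] [Algebra.FiniteType k A] [CommRing B] [IsDomain B] [Algebra A B]
    [FaithfulSMul A B] [Algebra.FiniteType A B] (q : Ideal B) [q.IsPrime]
    [Algebra.QuasiFiniteAt A q] :
    (q.under A).height ≤ q.height := by
  obtain ⟨r, hr, H⟩ := Algebra.ZariskisMainProperty.of_finiteType (R := A) q
  let C := integralClosure A B
  have hmap (c : C) : Localization.awayMap C.val.toRingHom r (algebraMap C _ c) =
      algebraMap B (Localization.Away r.1) c := by
    rw [Localization.awayMap, IsLocalization.Away.map, IsLocalization.map_eq]
    rfl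
  have hloc : IsLocalization.Away r (Localization.Away r.1) :=
    IsLocalization.isLocalization_of_algEquiv (.powers r)
      (AlgEquiv.ofBijective
        (AlgHom.mk (Localization.awayMap C.val.toRingHom r) fun c => hmap c) H)
  have hdisj : Disjoint (Submonoid.powers r.1 : Set B) q :=
    (Ideal.disjoint_powers_iff_notMem _ (Ideal.IsPrime.isRadical ‹_›)).mpr hr
  let Q := q.map (algebraMap B (Localization.Away r.1))
  have hQ : Q.IsPrime := IsLocalization.isPrime_of_isPrime_disjoint (.powers r.1) _ q ‹_› hdisj
  have hQq : Q.under B = q :=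
    IsLocalization.under_map_of_isPrime_disjoint (.powers r.1) _ ‹_› hdisj
  have h1 := IsLocalization.height_under (.powers r.1) Q
  have h2 := IsLocalization.height_under (.powers r) Q
  rw [hQq] at h1
  rw [← Ideal.under_under (B := B), hQq] at h2
  rw [h1, ← h2, ← Ideal.under_under (B := C)]
  exact height_under_le_of_isIntegral (k := k) _

end CommutativeAlgebra
-- Injective differentials and the unramified locus.
section Unramified

open IsLocalRing

/-- By duality the image of the cotangent map spans, since otherwise a nonzero functional would kill
it; Nakayama then lifts this from `𝔪_B / 𝔪_B²` to `𝔪_B`. -/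
theorem map_maximalIdeal_eq_of_cotangentMap {A B : Type*} [CommRing A] [IsLocalRing A] [CommRing B]
    [IsLocalRing B] [IsNoetherianRing B] (φ : A →+* B) [IsLocalHom φ]
    (h : ∀ D : Module.Dual (ResidueField B) (CotangentSpace B),
      D.comp (cotangentMap φ) = 0 → D = 0) :
    (maximalIdeal A).map φ = maximalIdeal B := by
  have hle : (maximalIdeal A).map φ ≤ maximalIdeal B :=
    Ideal.map_le_iff_le_comap.mpr fun a ha => map_nonunit φ a ha
  have hspan : Submodule.span (ResidueField B) (Set.range (cotangentMap φ)) = ⊤ := by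
    by_contra hne
    obtain ⟨D, hD, hDle⟩ := Submodule.exists_le_ker_of_lt_top _ (lt_top_iff_ne_top.mpr hne)
    refine hD (h D ?_)
    ext t
    exact hDle (Submodule.subset_span ⟨t, rfl⟩)
  have hmem : ∀ t : CotangentSpace B, ∃ y : maximalIdeal B,
      y.1 ∈ (maximalIdeal A).map φ ∧ (maximalIdeal B).toCotangent y = t := by
    intro t
    have ht : t ∈ Submodule.span (ResidueField B) (Set.range (cotangentMap φ)) := hspan ▸ trivial
    induction ht using Submodule.span_induction with
    | mem t ht =>
      obtain ⟨s, rfl⟩ := ht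
      obtain ⟨a, rfl⟩ := (maximalIdeal A).toCotangent_surjective s
      exact ⟨⟨φ a, map_nonunit φ a a.2⟩, Ideal.mem_map_of_mem φ a.2,
        (Ideal.mapCotangent_toCotangent _ _ φ.toIntAlgHom (maximalIdeal_le_comap φ) a).symm⟩
    | zero => exact ⟨0, Ideal.zero_mem _, map_zero _⟩
    | add s t _ _ hs ht =>
      obtain ⟨y, hy, rfl⟩ := hs
      obtain ⟨z, hz, rfl⟩ := ht
      exact ⟨y + z, Ideal.add_mem _ hy hz, map_add _ _ _⟩
    | smul r t _ ht =>
      obtain ⟨b, rfl⟩ := residue_surjective r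
      obtain ⟨y, hy, rfl⟩ := ht
      exact ⟨b • y, Ideal.mul_mem_left _ b hy, by rw [map_smul]; rfl⟩
  refine le_antisymm hle ?_
  refine Submodule.le_of_le_smul_of_le_jacobson_bot (I := maximalIdeal B)
    (IsNoetherian.noetherian _) (maximalIdeal_le_jacobson _) fun x hx => ?_
  obtain ⟨y, hy, hyx⟩ := hmem ((maximalIdeal B).toCotangent ⟨x, hx⟩)
  rw [Ideal.toCotangent_eq] at hyx
  have : x = y.1 - (y.1 - x) := by ring
  rw [this, smul_eq_mul, ← pow_two]
  exact Submodule.sub_mem _ (Submodule.mem_sup_left hy) (Submodule.mem_sup_right hyx)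

/-- The isomorphism `k ≅ κ(x)` at a closed point factors through `κ(f x)`. -/
theorem residueFieldMap_surjective {k : Type u} [Field k] [IsAlgClosed k] {X Z : Scheme.{u}}
    (pX : X ⟶ Spec (.of k)) (pZ : Z ⟶ Spec (.of k)) [LocallyOfFiniteType pX] (f : X ⟶ Z)
    (hf : f ≫ pZ = pX) (x : X) (hx : IsClosed {x}) :
    Function.Surjective (f.residueFieldMap x) := by
  have key : Spec.preimage (Z.fromSpecResidueField (f x) ≫ pZ) ≫ f.residueFieldMap x =
      (residueFieldIsoBase pX x hx).inv := by
    apply Spec.map_injective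
    rw [SpecMap_residueFieldIsoBase_inv, Spec.map_comp, Spec.map_preimage,
      Scheme.Hom.SpecMap_residueFieldMap_fromSpecResidueField_assoc, hf]
  have hs : Function.Surjective (residueFieldIsoBase pX x hx).inv :=
    (ConcreteCategory.bijective_of_isIso _).surjective
  rw [← key] at hs
  exact .of_comp (g := Spec.preimage (Z.fromSpecResidueField (f x) ≫ pZ)) (by simpa using hs)

theorem formallyUnramified_stalkMap {k : Type u} [Field k] [IsAlgClosed k] {X Z : Scheme.{u}}
    (pX : X ⟶ Spec (.of k)) (pZ : Z ⟶ Spec (.of k)) [LocallyOfFiniteType pX] (f : X ⟶ Z)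
    [LocallyOfFiniteType f] (hf : f ≫ pZ = pX) (x : X) (hx : IsClosed {x})
    (hd : Function.Injective (differential f x)) :
    (f.stalkMap x).hom.FormallyUnramified := by
  have : IsLocallyNoetherian X := LocallyOfFiniteType.isLocallyNoetherian pX
  have hmax := map_maximalIdeal_eq_of_cotangentMap (f.stalkMap x).hom fun D hD =>
    hd (hD.trans (map_zero (differential f x)).symm)
  have hess := LocallyOfFiniteType.stalkMap f x
  have hsurj : Function.Surjective (ResidueField.map (f.stalkMap x).hom) :=
    residueFieldMap_surjective pX pZ f hf x hx
  algebraize [(f.stalkMap x).hom]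
  have : IsLocalHom (algebraMap (Z.presheaf.stalk (f x)) (X.presheaf.stalk x)) :=
    inferInstanceAs <| IsLocalHom (f.stalkMap x).hom
  have hsurj' : Function.Surjective (algebraMap (ResidueField (Z.presheaf.stalk (f x)))
      (ResidueField (X.presheaf.stalk x))) := hsurj
  have : Algebra.IsSeparable (ResidueField (Z.presheaf.stalk (f x)))
      (ResidueField (X.presheaf.stalk x)) := by
    refine ⟨fun y => ?_⟩
    obtain ⟨a, rfl⟩ := hsurj' y
    exact isSeparable_algebraMap a
  have := Algebra.FormallyUnramified.of_map_maximalIdeal (R := Z.presheaf.stalk (f x))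
    (S := X.presheaf.stalk x) hmax
  exact this

theorem formallyUnramified_stalkMap_iff {X Y : Scheme.{u}} {f : X ⟶ Y} {x : X} (U : Y.Opens)
    (hU : IsAffineOpen U) (V : X.Opens) (hV : IsAffineOpen V) (hVU : V ≤ f ⁻¹ᵁ U) (hx : x ∈ V) :
    letI := (f.appLE U V hVU).hom.toAlgebra
    (f.stalkMap x).hom.FormallyUnramified ↔
      hV.primeIdealOf ⟨x, hx⟩ ∈ Algebra.unramifiedLocus Γ(Y, U) Γ(X, V) := by
  let := (f.appLE U V hVU).hom.toAlgebra
  let p := (hU.primeIdealOf ⟨f x, hVU hx⟩).asIdeal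
  let q := (hV.primeIdealOf ⟨x, hx⟩).asIdeal
  have : q.LiesOver p :=
    ⟨congr($(IsAffineOpen.comap_primeIdealOf_appLE U hU V hV hVU hx).1).symm⟩
  let := Localization.AtPrime.algebraOfLiesOver p q
  trans Algebra.FormallyUnramified (Localization.AtPrime p) (Localization.AtPrime q)
  · rw [← RingHom.formallyUnramified_algebraMap]
    exact RingHom.FormallyUnramified.respectsIso.arrow_mk_iso_iff
      (IsAffineOpen.arrowStalkMapIso f U hU V hV hVU hx)
  · exact ⟨fun _ ↦ Algebra.FormallyUnramified.comp Γ(Y, U) (Localization.AtPrime p)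
      (Localization.AtPrime q), fun h ↦
        have : Algebra.FormallyUnramified Γ(Y, U) (Localization.AtPrime q) := h
        .of_restrictScalars Γ(Y, U) _ _⟩

theorem isOpen_formallyUnramified_stalkMap {X Y : Scheme.{u}} (f : X ⟶ Y)
    [LocallyOfFiniteType f] : IsOpen {x | (f.stalkMap x).hom.FormallyUnramified} := by
  refine isOpen_iff_forall_mem_open.mpr fun x hx => ?_
  obtain ⟨_, ⟨U, hU, rfl⟩, hxU, -⟩ :=
    Y.isBasis_affineOpens.exists_subset_of_mem_open (Set.mem_univ (f x)) isOpen_univ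
  obtain ⟨_, ⟨V, hV, rfl⟩, hxV, hVU⟩ :=
    X.isBasis_affineOpens.exists_subset_of_mem_open hxU (U.2.preimage f.continuous)
  have := f.finiteType_appLE hU hV hVU
  algebraize [(f.appLE U V hVU).hom]
  have hopen := (Algebra.isOpen_unramifiedLocus (R := Γ(Y, U)) (A := Γ(X, V))).preimage
    hV.isoSpec.hom.continuous
  refine ⟨_, ?_, V.2.isOpenEmbedding_subtypeVal.isOpenMap _ hopen, ⟨⟨x, hxV⟩, ?_, rfl⟩⟩
  · rintro _ ⟨⟨y, hyV⟩, hy, rfl⟩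
    exact (formallyUnramified_stalkMap_iff U hU V hV hVU hyV).mpr hy
  · exact (formallyUnramified_stalkMap_iff U hU V hV hVU hxV).mp hx

theorem quasiFiniteAt_of_formallyUnramified_stalkMap {X Y : Scheme.{u}} (f : X ⟶ Y)
    [LocallyOfFiniteType f] (x : X) (hx : (f.stalkMap x).hom.FormallyUnramified) :
    f.QuasiFiniteAt x := by
  have hess := LocallyOfFiniteType.stalkMap f x
  change (f.stalkMap x).hom.QuasiFinite
  algebraize [(f.stalkMap x).hom]
  exact inferInstanceAs (Algebra.QuasiFinite (Y.presheaf.stalk (f x)) (X.presheaf.stalk x))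

end Unramified
-- Codimension and quasi-finite points.
section Codimension

open Order

theorem codim_le_coheight {X : Scheme.{u}} {A : Set X} (hA : IsClosed A) {x : X} (hx : x ∈ A) :
    codim A ≤ coheight x := by
  rw [← coheight_orderIso (irreducibleSetEquivPoints (α := X)).symm x]
  exact iInf₂_le ((irreducibleSetEquivPoints (α := X)).symm x)
    ((hA.closure_subset_iff).mpr (Set.singleton_subset_iff.mpr hx))

theorem coheight_le_codim_closure_singleton {X : Scheme.{u}} (x : X) :
    coheight x ≤ codim (closure {x}) := by
  rw [← coheight_orderIso (irreducibleSetEquivPoints (α := X)).symm x]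
  exact le_iInf₂ fun B hB => coheight_anti hB

theorem height_primeIdealOf {X : Scheme.{u}} {U : X.Opens} (hU : IsAffineOpen U) (x : U) :
    (hU.primeIdealOf x).asIdeal.height = coheight x.1 := by
  exact (idealHeight_eq_coheight Γ(X, U) (hU.primeIdealOf x)).trans
    ((coheight_eq_of_isOpenImmersion hU.fromSpec).symm.trans
      (congrArg _ (hU.fromSpec_primeIdealOf x)))

theorem coheight_map_le_of_quasiFiniteAt {k : Type u} [Field k] {X Z : Scheme.{u}}
    (pZ : Z ⟶ Spec (.of k)) [LocallyOfFiniteType pZ] [IsIntegral X] [IsIntegral Z]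
    (f : X ⟶ Z) [LocallyOfFiniteType f] [QuasiCompact f] [IsDominant f] (x : X)
    (hx : f.QuasiFiniteAt x) :
    coheight (f x) ≤ coheight x := by
  obtain ⟨_, ⟨U, hU, rfl⟩, hxU, -⟩ :=
    Z.isBasis_affineOpens.exists_subset_of_mem_open (Set.mem_univ (f x)) isOpen_univ
  obtain ⟨_, ⟨V, hV, rfl⟩, hxV, hVU⟩ :=
    X.isBasis_affineOpens.exists_subset_of_mem_open hxU (U.2.preimage f.continuous)
  have hqf := hx.quasiFiniteAt hV hU hVU hxV
  have hcomap := IsAffineOpen.comap_primeIdealOf_appLE (f := f) U hU V hV hVU hxV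
  have hV0 : Nonempty V := ⟨⟨x, hxV⟩⟩
  have hU0 : Nonempty U := ⟨⟨f x, hxU⟩⟩
  have : IsSchemeTheoreticallyDominant f := .of_isDominant f
  have hinj : Function.Injective (f.appLE U V hVU).hom := by
    change Function.Injective (f.app U ≫ X.presheaf.map (homOfLE hVU).op).hom
    rw [CommRingCat.hom_comp]
    exact (map_injective_of_isIntegral X (homOfLE hVU)).comp (f.app_injective U)
  have hft := f.finiteType_appLE hU hV hVU
  have hk : ((pZ.appLE ⊤ U le_top).hom.comp (Scheme.ΓSpecIso (.of k)).inv.hom).FiniteType :=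
    (pZ.finiteType_appLE (isAffineOpen_top _) hU le_top).comp
      (RingHom.FiniteType.of_surjective _
        (ConcreteCategory.bijective_of_isIso (Scheme.ΓSpecIso (.of k)).inv).surjective)
  algebraize [(f.appLE U V hVU).hom,
    (pZ.appLE ⊤ U le_top).hom.comp (Scheme.ΓSpecIso (.of k)).inv.hom]
  have : FaithfulSMul Γ(Z, U) Γ(X, V) := (faithfulSMul_iff_algebraMap_injective _ _).mpr hinj
  have := height_under_le_of_quasiFiniteAt (k := k) (A := Γ(Z, U))
    (hV.primeIdealOf ⟨x, hxV⟩).asIdeal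
  refine le_trans (le_of_eq ?_) (this.trans_eq (height_primeIdealOf hV ⟨x, hxV⟩))
  refine (height_primeIdealOf hU ⟨f x, hxU⟩).symm.trans ?_
  rw [← hcomap]
  rfl

end Codimension

/-! ### Counting points in fibres. -/

section Fibres

/-- A quasi-finite point is closed in its fibre, so it has no other specialization there. -/
theorem eq_of_specializes_of_quasiFiniteAt {X Z : Scheme.{u}} (f : X ⟶ Z) [LocallyOfFiniteType f]
    {x y : X} (hx : f.QuasiFiniteAt x) (hxy : x ⤳ y) (hfy : f y = f x) : y = x := by
  have hcl := hx.isClopen_singleton_asFiber.1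
  rw [← (f.fiberHomeo (f x)).isClosed_image, Set.image_singleton] at hcl
  have hsp : (⟨x, rfl⟩ : f ⁻¹' {f x}) ⤳ ⟨y, hfy⟩ :=
    Topology.IsInducing.subtypeVal.specializes_iff.mp hxy
  have := hsp.mem_closed hcl (by simp [Scheme.Hom.asFiber])
  simpa [Scheme.Hom.asFiber] using congrArg Subtype.val this

theorem isClosed_singleton_of_quasiFiniteAt {X Z : Scheme.{u}} (f : X ⟶ Z) [LocallyOfFiniteType f]
    {x : X} (hx : f.QuasiFiniteAt x) (hfx : IsClosed {f x}) : IsClosed {x} := by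
  refine isClosed_of_closure_subset fun y hy => ?_
  have hxy : x ⤳ y := specializes_iff_mem_closure.mpr hy
  exact eq_of_specializes_of_quasiFiniteAt f hx hxy
    ((hxy.map f.continuous).mem_closed hfx rfl)

theorem isAlgClosed_residueField {k A : Type u} [Field k] [IsAlgClosed k] [CommRing A] [Algebra k A]
    [Algebra.FiniteType k A] (p : Ideal A) [p.IsMaximal] : IsAlgClosed p.ResidueField := by
  have : Module.Finite k (A ⧸ p) := by
    let := Ideal.Quotient.field p
    exact finite_of_finite_type_of_isJacobsonRing k (A ⧸ p)
  have hint : ((algebraMap (A ⧸ p) p.ResidueField).comp (algebraMap k (A ⧸ p))).IsIntegral :=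
    RingHom.IsIntegral.trans _ _ (algebraMap_isIntegral_iff.mpr inferInstance)
      (RingHom.isIntegral_of_surjective _ (Ideal.bijective_algebraMap_quotient_residueField p).2)
  exact IsAlgClosed.of_ringEquiv k _
    (RingEquiv.ofBijective _ (IsAlgClosed.ringHom_bijective_of_isIntegral _ hint))

theorem exists_encard_fibre_Spec {k : Type u} [Field k] [IsAlgClosed k] {A B : Type u}
    [CommRing A] [IsDomain A] [Algebra k A] [Algebra.FiniteType k A] [CommRing B] [Algebra A B]
    [Module.Finite A B] [Algebra.FormallyUnramified A B] :
    ∃ m : ℕ, (∀ p : PrimeSpectrum A, p.asIdeal.IsMaximal →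
        m ≤ (PrimeSpectrum.comap (algebraMap A B) ⁻¹' {p}).encard) ∧
      ∃ U : Opens (PrimeSpectrum A), (U : Set (PrimeSpectrum A)).Nonempty ∧
        ∀ p ∈ U, p.asIdeal.IsMaximal →
          (PrimeSpectrum.comap (algebraMap A B) ⁻¹' {p}).encard = m := by
  have : IsNoetherianRing A := Algebra.FiniteType.isNoetherianRing k A
  obtain ⟨g, hg, hgm⟩ := exists_finrank_fiber_eq A B
  refine ⟨Module.finrank A B, fun p hp => ?_, PrimeSpectrum.basicOpen g, ⟨⊥, hg⟩,
    fun p hpg hp => ?_⟩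
  · have := isAlgClosed_residueField (k := k) p.asIdeal
    rw [encard_preimage_eq_finrank_fiber]
    exact_mod_cast finrank_le_finrank_fiber p.asIdeal
  · have := isAlgClosed_residueField (k := k) p.asIdeal
    rw [encard_preimage_eq_finrank_fiber, hgm p.asIdeal hpg]

theorem exists_encard_fibre {k : Type u} [Field k] [IsAlgClosed k] {X Z : Scheme.{u}}
    (pZ : Z ⟶ Spec (.of k)) [LocallyOfFiniteType pZ] [IsIntegral Z] [IsAffine Z]
    (f : X ⟶ Z) [IsFinite f] [FormallyUnramified f] :
    ∃ m : ℕ, (∀ z : Z, IsClosed {z} → m ≤ (f ⁻¹' {z}).encard) ∧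
      ∃ U : Z.Opens, (U : Set Z).Nonempty ∧
        ∀ z ∈ U, IsClosed {z} → (f ⁻¹' {z}).encard = m := by
  have : IsAffine X := isAffine_of_isAffineHom f
  have hk : (pZ.appTop.hom.comp (Scheme.ΓSpecIso (.of k)).inv.hom).FiniteType :=
    RingHom.FiniteType.comp (HasRingHomProperty.appTop (P := @LocallyOfFiniteType) pZ ‹_›)
      (RingHom.FiniteType.of_surjective _
        (ConcreteCategory.bijective_of_isIso (Scheme.ΓSpecIso (.of k)).inv).surjective)
  have hfin : f.appTop.hom.Finite := f.finite_appTop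
  have hunr : f.appTop.hom.FormallyUnramified :=
    HasRingHomProperty.appTop (P := @FormallyUnramified) f ‹_›
  algebraize [f.appTop.hom, pZ.appTop.hom.comp (Scheme.ΓSpecIso (.of k)).inv.hom]
  obtain ⟨m, hm, U, hU, hUm⟩ := exists_encard_fibre_Spec (k := k) (A := Γ(Z, ⊤)) (B := Γ(X, ⊤))
  have hfib (z : Z) : (f ⁻¹' {z}).encard =
      (PrimeSpectrum.comap (algebraMap Γ(Z, ⊤) Γ(X, ⊤)) ⁻¹' {Z.isoSpec.hom z}).encard := by
    have h : f ⁻¹' {z} = X.isoSpec.hom ⁻¹'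
        (PrimeSpectrum.comap (algebraMap Γ(Z, ⊤) Γ(X, ⊤)) ⁻¹' {Z.isoSpec.hom z}) := by
      ext x
      have hx : PrimeSpectrum.comap (algebraMap Γ(Z, ⊤) Γ(X, ⊤)) (X.isoSpec.hom x) =
          Z.isoSpec.hom (f x) := by
        rw [← Scheme.Hom.comp_apply, ← Scheme.isoSpec_hom_naturality, Scheme.Hom.comp_apply]
        rfl
      change f x = z ↔ PrimeSpectrum.comap (algebraMap Γ(Z, ⊤) Γ(X, ⊤)) (X.isoSpec.hom x) =
        Z.isoSpec.hom z
      rw [hx]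
      exact Z.isoSpec.hom.homeomorph.injective.eq_iff.symm
    rw [h]
    exact Set.encard_preimage_of_bijective X.isoSpec.hom.homeomorph.bijective _
  have hmax (z : Z) (hz : IsClosed {z}) :
      (PrimeSpectrum.asIdeal (Z.isoSpec.hom z)).IsMaximal := by
    refine (PrimeSpectrum.isClosed_singleton_iff_isMaximal _).mp ?_
    have := Z.isoSpec.hom.homeomorph.isClosedMap _ hz
    rwa [Set.image_singleton] at this
  refine ⟨m, fun z hz => ?_, Z.isoSpec.hom ⁻¹ᵁ U, ?_, fun z hzU hz => ?_⟩
  · rw [hfib]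
    exact hm _ (hmax z hz)
  · exact hU.preimage Z.isoSpec.hom.homeomorph.surjective
  · rw [hfib]
    exact hUm _ hzU (hmax z hz)

end Fibres
-- Restriction over an open subset of the target.
theorem encard_preimage_morphismRestrict {X Z : Scheme.{u}} (f : X ⟶ Z) (U : Z.Opens) (z : U) :
    ((f ∣_ U) ⁻¹' {z}).encard = (f ⁻¹' {z.1}).encard := by
  have h : f ⁻¹' {z.1} = (f ⁻¹ᵁ U).ι '' ((f ∣_ U) ⁻¹' {z}) := by
    ext x
    constructor
    · rintro (hx : f x = z.1)
      have hxU : x ∈ f ⁻¹ᵁ U := show f x ∈ U from hx ▸ z.2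
      exact ⟨⟨x, hxU⟩, Subtype.ext ((morphismRestrict_base_coe f U ⟨x, hxU⟩).trans hx), rfl⟩
    · rintro ⟨x, hx, rfl⟩
      have := congrArg Subtype.val (show (f ∣_ U) x = z from hx)
      rwa [morphismRestrict_base_coe] at this
  rw [h, (f ⁻¹ᵁ U).ι.injective.encard_image]

theorem formallyUnramified_morphismRestrict {X Z : Scheme.{u}} (f : X ⟶ Z) (U : Z.Opens)
    (h : ∀ x, f x ∈ U → (f.stalkMap x).hom.FormallyUnramified) :
    FormallyUnramified (f ∣_ U) := by
  refine HasRingHomProperty.of_stalkMap RingHom.FormallyUnramified.ofLocalizationPrime fun x => ?_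
  rw [RingHom.FormallyUnramified.respectsIso.arrow_mk_iso_iff (morphismRestrictStalkMap f U x)]
  exact h x.1 x.2

theorem isFinite_of_formallyUnramified {X Z : Scheme.{u}} (f : X ⟶ Z) [IsProper f]
    [FormallyUnramified f] : IsFinite f := by
  have : LocallyQuasiFinite f := by
    rw [← Scheme.Hom.quasiFiniteLocus_eq_top_iff]
    exact top_le_iff.mp fun x _ =>
      quasiFiniteAt_of_formallyUnramified_stalkMap f x (FormallyUnramified.stalkMap f x)
  exact IsFinite.of_isProper_of_locallyQuasiFinite f

end GenericDegree

/-! ### The degree near the image of the generic point of `Y`. -/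

theorem lemma3p4 {k : Type u} [Field k] [IsAlgClosed k] {X Z : Scheme.{u}}
    -- `X` and `Z` are varieties over `k`
    (pX : X ⟶ Spec (.of k)) (pZ : Z ⟶ Spec (.of k))
    [IsIntegral X] [IsSeparated pX] [LocallyOfFiniteType pX] [QuasiCompact pX]
    [IsIntegral Z] [IsSeparated pZ] [LocallyOfFiniteType pZ] [QuasiCompact pZ]
    -- `f` is a proper, surjective, generically finite morphism of varieties over `k`
    (f : X ⟶ Z) (hf : f ≫ pZ = pX) [IsProper f] [Surjective f]
    (hfin : GenericDegree.GenericallyFinite f)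
    -- `Y` is an integral locally closed subset of codimension one, not inside the singular locus
    (Y : Set X) (hYlc : IsLocallyClosed Y) (hYirr : IsIrreducible Y)
    (hYcodim : GenericDegree.codim (closure Y) = 1)
    (hYsing : ¬ Y ⊆ GenericDegree.singularLocus X)
    -- the closure of `f(Y) ∩ f(Yᶜ)` has codimension at least two
    (h1 : 2 ≤ GenericDegree.codim (closure (f '' Y ∩ f '' Yᶜ)))
    -- `df` is injective at the (closed) points of a nonempty open subset of `Y`
    (h2 : ∃ W : X.Opens, ((W : Set X) ∩ Y).Nonempty ∧
      ∀ x ∈ (W : Set X) ∩ Y, x ∈ closedPoints X →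
        Function.Injective (GenericDegree.differential f x))
    -- the fibres over the (closed) points of a nonempty open subset of `f(Y)` have `n` elements
    (n : ℕ)
    (h3 : ∃ V : Z.Opens, ((V : Set Z) ∩ f '' Y).Nonempty ∧
      ∀ z ∈ (V : Set Z) ∩ f '' Y, z ∈ closedPoints Z →
        (GenericDegree.closedFiber f z).encard = n) :
    ∃ m : ℕ, m ≤ n ∧ ∃ U : Z.Opens, (U : Set Z).Nonempty ∧
      ∀ z ∈ U, z ∈ closedPoints Z → (GenericDegree.closedFiber f z).encard = m := by
  open GenericDegree in
  have : JacobsonSpace X := LocallyOfFiniteType.jacobsonSpace pX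
  obtain ⟨W, hWY, hW⟩ := h2
  obtain ⟨V, ⟨z₁, hz₁V, y₁, hy₁, rfl⟩, hV⟩ := h3
  -- the generic point of `Y`
  obtain ⟨η, hη⟩ := QuasiSober.sober hYirr.closure isClosed_closure
  have hηmem (O : Set X) (hO : IsOpen O) (h : (O ∩ Y).Nonempty) : η ∈ O :=
    (hη.mem_open_set_iff hO).mpr
      (by rw [Set.inter_comm]; exact h.mono (Set.inter_subset_inter_right _ subset_closure))
  have hηY : η ∈ Y := by
    obtain ⟨O, C, hO, hC, rfl⟩ := hYlc
    exact ⟨hηmem O hO (by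
      obtain ⟨y, hy⟩ := hYirr.nonempty
      exact ⟨y, hy.1, hy⟩), closure_minimal Set.inter_subset_right hC (hη.mem)⟩
  -- the unramified locus contains `η`
  have hOopen := isOpen_formallyUnramified_stalkMap f
  set O : Set X := {x | (f.stalkMap x).hom.FormallyUnramified}
  have hηO : η ∈ O := by
    obtain ⟨x, ⟨hxW, hxY⟩, hx⟩ :=
      nonempty_inter_closedPoints hWY (W.isOpen.isLocallyClosed.inter hYlc)
    exact hηmem O hOopen
      ⟨x, formallyUnramified_stalkMap pX pZ f hf x hx (hW x ⟨hxW, hxY⟩ hx), hxY⟩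
  have hqf : f.QuasiFiniteAt η := quasiFiniteAt_of_formallyUnramified_stalkMap f η hηO
  -- the fibre through `η` is contained in `Y`
  have hηH : f η ∉ closure (f '' Y ∩ f '' Yᶜ) := fun hmem => by
    have h := (codim_le_coheight isClosed_closure hmem).trans
      ((coheight_map_le_of_quasiFiniteAt pZ f η hqf).trans
        (coheight_le_codim_closure_singleton η))
    rw [hη.def, hYcodim] at h
    exact absurd (h1.trans h) (by norm_num)
  have hfibre (x : X) (hx : f x = f η) : x = η := by
    have hxY : x ∈ Y := by
      by_contra hxY
      exact hηH (subset_closure ⟨⟨η, hηY, rfl⟩, x, hxY, hx⟩)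
    exact eq_of_specializes_of_quasiFiniteAt f hqf (hη.specializes (subset_closure hxY)) hx
  -- an affine neighbourhood of `f η` over which `f` is finite and unramified
  obtain ⟨_, ⟨U : Z.Opens, hU, rfl⟩, hηU, hUsub⟩ :=
    Z.isBasis_affineOpens.exists_subset_of_mem_open
      (u := (f '' Oᶜ)ᶜ ∩ V) (a := f η)
      ⟨by rintro ⟨x, hx, hfx⟩; exact hx (hfibre x hfx ▸ hηO),
        hηmem (f ⁻¹' V) (V.isOpen.preimage f.continuous) ⟨y₁, hz₁V, hy₁⟩⟩
      ((f.isClosedMap _ hOopen.isClosed_compl).isOpen_compl.inter V.isOpen)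
  have hUO (x : X) (hx : f x ∈ U) : x ∈ O := by
    by_contra hxO
    exact (hUsub hx).1 ⟨x, hxO, rfl⟩
  have := formallyUnramified_morphismRestrict f U hUO
  have := isFinite_of_formallyUnramified (f ∣_ U)
  have : IsAffine U := hU
  have : Nonempty U := ⟨⟨f η, hηU⟩⟩
  obtain ⟨m, hm, U', hU', hUm⟩ := exists_encard_fibre (U.ι ≫ pZ) (f ∣_ U)
  have hclosed (z : U) (hz : IsClosed {z.1}) :
      IsClosed {z} ∧ ((f ∣_ U) ⁻¹' {z}).encard = (closedFiber f z.1).encard := by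
    refine ⟨?_, ?_⟩
    · convert hz.preimage continuous_subtype_val
      ext w
      exact Subtype.ext_iff
    · rw [encard_preimage_morphismRestrict]
      congr 1
      ext x
      -- `closedFiber` counts only closed points, but over a closed point of `U` quasi-finiteness
      -- makes every point of the fibre closed.
      refine ⟨fun hx => ⟨?_, hx⟩, fun hx => hx.2⟩
      have hx' : f x = z.1 := hx
      exact isClosed_singleton_of_quasiFiniteAt f
        (quasiFiniteAt_of_formallyUnramified_stalkMap f x (hUO x (hx' ▸ z.2))) (hx' ▸ hz)
  refine ⟨m, ?_, U.ι ''ᵁ U', hU'.image _, ?_⟩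
  -- `U` was chosen inside `V`, so the fibre through a closed point of `Y` over `U` has exactly `n`
  -- points.
  · obtain ⟨x, ⟨hxU, hxY⟩, hx⟩ := nonempty_inter_closedPoints (Z := f ⁻¹' U ∩ Y) ⟨η, hηU, hηY⟩
      ((U.isOpen.preimage f.continuous).isLocallyClosed.inter hYlc)
    have hfx : IsClosed {f x} := by
      simpa using f.isClosedMap _ hx
    obtain ⟨hc, he⟩ := hclosed ⟨f x, hxU⟩ hfx
    have hn := hV (f x) ⟨(hUsub hxU).2, x, hxY, rfl⟩ hfx
    exact_mod_cast (hm _ hc).trans (he.trans hn).le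
  · rintro _ ⟨z, hz, rfl⟩ hzc
    obtain ⟨hc, he⟩ := hclosed z hzc
    exact he.symm.trans (hUm z hz hc)
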